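/- Let $B$ be a Polish (complete separable) metric space. A $B$-field $\mathcal X=(X,d_X,\pi_X)$ is a Polish metric space $X$ with a $1$-Lipschitz map $\pi_X\colon X\to B$; a metric measure $B$-field carries in addition a Borel probability measure $\mu_X$ on $X$. An isometric embedding of $B$-fields $\mathcal X\to\mathcal Z$ is an isometric embedding $\phi\colon X\to Z$ with $\pi_Z\circ\phi=\pi_X$. Put $$d_{GH}(\mathcal X,\mathcal Y)=\inf d_H^Z(\phi(X),\psi(Y)),\qquad d_{GP}(\mathcal X,\mathcal Y)=\inf d_P^Z(\phi_*\mu_X,\psi_*\mu_Y),$$ where $d_H^Z$ and $d_P^Z$ are the Hausdorff and Prokhorov distances in $Z$ and the infima are over all $B$-fields $\mathcal Z$ and isometric embeddings of $B$-fields $\phi\colon\mathcal X\to\mathcal Z$, $\psi\colon\mathcal Y\to\mathcal Z$. All distances take values in $[0,\infty]$. For $C\subseteq B$ let $\mathrm{rad}(C)=\inf_{b\in B}\sup_{c\in C}d_B(b,c)$. For $r,s,t\ge 0$ let $VR^{r,s}(\mathcal X)$ be the simplicial complex whose simplices are the finite nonempty $A\subseteq X$ with $\mathrm{diam}(A)\le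 r$ and $\mathrm{rad}(\pi_X(A))\le s/2$, and let $VR^{r,s,t}(\mathcal X)$ be the simplicial complex whose simplices are the nonempty finite chains $\{A_0\subseteq\dots\subseteq A_n\}$ of Borel subsets of $X$ (the empty set being allowed as an $A_i$, with $\mathrm{diam}(\emptyset)=\mathrm{rad}(\emptyset)=0$) such that $\mathrm{diam}(A_i)\le r$, $\mathrm{rad}(\pi_X(A_i))\le s/2$ and $\mu_X(A_i)\ge 1-t$ for all $i$. Taking geometric realizations (with the weak topology), these are functors $VR^{*,*}(\mathcal X)$ and $VR^{*,*,*}(\mathcal X)$ to topological spaces from the posets $[0,\infty)^2$ and $[0,\infty)^3$ with the componentwise order. Two functors $F,G\colon[0,\infty)^n\to\mathbf{Top}$ are weakly equivalent if they are connected by a finite zigzag of natural transformations that are objectwise weak homotopy equivalences. They are $\delta$-interleaved ($\delta\ge0$) if there are natural transformations $F(a)\to G(a+\delta(1,\dots,1))$ and $G(a)\to F(a+\delta(1,\dots,1))$ whose two composites are the structure maps of $F$ and $G$ from $a$ to $a+2\delta(1,\dots,1)$. The homotopy interleaving distance $d_{HI}(F,G)$ is the infimum of the $\delta\ge 0$ such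 that $F$ and $G$ are weakly equivalent to functors $F'$ and $G'$ that are $\delta$-interleaved. Theorem. Let $\mathcal X$ and $\mathcal Y$ be metric measure $B$-fields. Then (i) $d_{HI}(VR^{*,*}(\mathcal X),VR^{*,*}(\mathcal Y))\le 2\,d_{GH}(\mathcal X,\mathcal Y)$, and (ii) $d_{HI}(VR^{*,*,*}(\mathcal X),VR^{*,*,*}(\mathcal Y))\le 2\,d_{GP}(\mathcal X,\mathcal Y)$. -/

import Mathlib

open CategoryTheory MeasureTheory
open scoped ENNReal NNReal

universe u v

noncomputable section

namespace FieldVR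



/-! ### Fields and metric measure fields over a metric space -/

/-- A `B`-field: a Polish (complete separable) metric space together with a `1`-Lipschitz map
to the metric space `B`. -/
structure BField (B : Type v) [MetricSpace B] where
  /-- the domain of the field -/
  carrier : Type u
  [metric : MetricSpace carrier]
  [complete : CompleteSpace carrier]
  [separable : TopologicalSpace.SeparableSpace carrier]
  /-- the field map -/
  proj : carrier → B
  lipschitz : LipschitzWith 1 proj

attribute [instance] BField.metric BField.complete BField.separable

section Fields

variable {B : Type v} [MetricSpace B]

instance : CoeSort (BField.{u, v} B) (Type u) := ⟨BField.carrier⟩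

/-- The domain of a field carries its Borel `σ`-algebra. -/
instance (X : BField.{u, v} B) : MeasurableSpace X := borel X

instance (X : BField.{u, v} B) : BorelSpace X := ⟨rfl⟩

variable (B) in
/-- A metric measure field over `B`: a `B`-field with a Borel probability measure on its domain. -/
structure MMField where
  /-- the underlying field -/
  field : BField.{u, v} B
  /-- the probability measure -/
  measure : ProbabilityMeasure field

/-- Isometric embeddings of fields over `B`. -/
structure BFieldEmbedding (X Z : BField.{u, v} B) where
  /-- the underlying map -/
  toFun : X → Z
  isometry : Isometry toFun
  comm : ∀ x, Z.proj (toFun x) = X.proj x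

/-- The Gromov-Hausdorff distance between `B`-fields (infinite if there is no pair of embeddings
at finite Hausdorff distance). -/
def gromovHausdorffDist (X Y : BField.{u, v} B) : ℝ≥0∞ :=
  ⨅ (Z : BField.{u, v} B) (φ : BFieldEmbedding X Z) (ψ : BFieldEmbedding Y Z),
    Metric.hausdorffEDist (Set.range φ.toFun) (Set.range ψ.toFun)

/-- The Gromov-Prokhorov distance between metric measure fields over `B`. -/
def gromovProkhorovDist (X Y : MMField.{u, v} B) : ℝ≥0∞ :=
  ⨅ (Z : BField.{u, v} B) (φ : BFieldEmbedding X.field Z) (ψ : BFieldEmbedding Y.field Z),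
    levyProkhorovEDist ((X.measure : Measure X.field).map φ.toFun)
      ((Y.measure : Measure Y.field).map ψ.toFun)

end Fields

/-- The index poset `[0, ∞)ⁿ` of `n`-parameter filtrations, with the componentwise order. -/
def Index (n : ℕ) : Type := Fin n → ℝ≥0

instance (n : ℕ) : PartialOrder (Index n) := inferInstanceAs (PartialOrder (Fin n → ℝ≥0))

/-! ### The Vietoris-Rips multifiltrations -/

section Rips

variable {B : Type v} [MetricSpace B]

/-- The radius `inf_{b} sup_{c ∈ C} d(b, c)` of a subset `C` of a metric space. -/
def radius (C : Set B) : ℝ≥0∞ := ⨅ b : B, ⨆ c ∈ C, edist b c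

lemma radius_mono {C D : Set B} (h : C ⊆ D) : radius C ≤ radius D :=
  iInf_mono fun _ => biSup_mono h

/-- The field Vietoris-Rips bifiltration. Its vertices are points of `X`, and at the index
`a = (r, s)` its simplices are the finite nonempty subsets of diameter at most `r` whose image
in `B` has radius at most `s / 2`. -/
def ripsBifiltration (X : BField.{u, v} B) :
    Index 2 →o PreAbstractSimplicialComplex X where
  toFun a :=
    { faces := {σ | σ.Nonempty ∧ Metric.ediam (σ : Set X) ≤ (a 0 : ℝ≥0∞) ∧
        radius (X.proj '' (σ : Set X)) ≤ (a 1 : ℝ≥0∞) / 2}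
      isRelLowerSet_faces := fun _ hσ => ⟨hσ.1, fun _ hτσ hτ =>
        ⟨hτ, (Metric.ediam_mono (Finset.coe_subset.2 hτσ)).trans hσ.2.1,
          (radius_mono (Set.image_mono (Finset.coe_subset.2 hτσ))).trans hσ.2.2⟩⟩ }
  monotone' _ _ hab _ hσ :=
    ⟨hσ.1, hσ.2.1.trans (ENNReal.coe_le_coe.2 (hab 0)),
      hσ.2.2.trans (ENNReal.div_le_div_right (ENNReal.coe_le_coe.2 (hab 1)) 2)⟩

/-- The metric measure field Vietoris-Rips trifiltration. Its vertices are Borel subsets `A` of `X`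
(possibly empty or infinite), and at the index `a = (r, s, t)` its simplices are the nonempty
finite chains, with respect to inclusion, of Borel sets of diameter at most `r`, whose image in `B`
has radius at most `s / 2`, and whose measure is at least `1 - t`. (The subtraction is truncated
at `0`, which does not change the last condition.) -/
def ripsTrifiltration (X : MMField.{u, v} B) :
    Index 3 →o PreAbstractSimplicialComplex (Set X.field) where
  toFun a :=
    { faces := {σ | σ.Nonempty ∧
        IsChain (fun A C : Set X.field => A ⊆ C) (σ : Set (Set X.field)) ∧
        ∀ A ∈ σ, MeasurableSet A ∧ Metric.ediam A ≤ (a 0 : ℝ≥0∞) ∧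
          radius (X.field.proj '' A) ≤ (a 1 : ℝ≥0∞) / 2 ∧
          1 - (a 2 : ℝ≥0∞) ≤ (X.measure : Measure X.field) A}
      isRelLowerSet_faces := fun _ hσ => ⟨hσ.1, fun _ hτσ hτ =>
        ⟨hτ, hσ.2.1.mono (Finset.coe_subset.2 hτσ), fun A hA => hσ.2.2 A (hτσ hA)⟩⟩ }
  monotone' _ _ hab _ hσ :=
    ⟨hσ.1, hσ.2.1, fun A hA =>
      have h := hσ.2.2 A hA
      ⟨h.1, h.2.1.trans (ENNReal.coe_le_coe.2 (hab 0)),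
        h.2.2.1.trans (ENNReal.div_le_div_right (ENNReal.coe_le_coe.2 (hab 1)) 2),
        (tsub_le_tsub_left (ENNReal.coe_le_coe.2 (hab 2)) 1).trans h.2.2.2⟩⟩

end Rips

/-! ### Geometric realization of abstract simplicial complexes -/

section Realization

variable {V : Type u}

/-- The closed simplex spanned by a finite set `σ` of vertices, in barycentric coordinates. -/
def closedSimplex (σ : Finset V) : Set (V → ℝ) :=
  {w | (∀ v, 0 ≤ w v) ∧ (∀ v, v ∉ σ → w v = 0) ∧ ∑ v ∈ σ, w v = 1}

/-- The underlying set of the geometric realization: the union of the closed simplices. -/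
def Realization (K : PreAbstractSimplicialComplex V) : Type u :=
  {w : V → ℝ // ∃ σ ∈ K.faces, w ∈ closedSimplex σ}

/-- The inclusion of a closed simplex in the geometric realization. -/
def simplexInclusion (K : PreAbstractSimplicialComplex V) (σ : K.faces) :
    closedSimplex (σ : Finset V) → Realization K :=
  fun w => ⟨w.1, σ.1, σ.2, w.2⟩

/-- The weak topology: the finest topology for which the inclusions of all the closed simplices
(with their Euclidean topology) are continuous. -/
instance (K : PreAbstractSimplicialComplex V) : TopologicalSpace (Realization K) :=
  ⨆ σ : K.faces, TopologicalSpace.coinduced (simplexInclusion K σ) inferInstance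

lemma continuous_realization_iff {K : PreAbstractSimplicialComplex V} {Z : Type*}
    [TopologicalSpace Z] {f : Realization K → Z} :
    Continuous f ↔ ∀ σ : K.faces, Continuous (f ∘ simplexInclusion K σ) := by
  simp only [continuous_iSup_dom, continuous_coinduced_dom]

lemma continuous_simplexInclusion (K : PreAbstractSimplicialComplex V) (σ : K.faces) :
    Continuous (simplexInclusion K σ) :=
  continuous_realization_iff.1 continuous_id σ

/-- The inclusion of realizations induced by the inclusion of a subcomplex. -/
def realizationInclusion {K L : PreAbstractSimplicialComplex V} (h : K ≤ L) :
    C(Realization K, Realization L) where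
  toFun w := ⟨w.1, w.2.choose, h w.2.choose_spec.1, w.2.choose_spec.2⟩
  continuous_toFun := continuous_realization_iff.2 fun σ =>
    continuous_simplexInclusion L ⟨σ.1, h σ.2⟩

/-- Geometric realization, as a functor on the poset of simplicial complexes with vertices
in `V`. -/
def realizationFunctor (V : Type u) : PreAbstractSimplicialComplex V ⥤ TopCat.{u} where
  obj K := TopCat.of (Realization K)
  map h := TopCat.ofHom (realizationInclusion (leOfHom h))
  map_id _ := rfl
  map_comp _ _ := rfl

/-- The diagram of spaces of an `n`-parameter filtration by simplicial complexes. -/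
def filtrationDiagram {n : ℕ} (K : Index n →o PreAbstractSimplicialComplex V) :
    Index n ⥤ TopCat.{u} :=
  K.monotone.functor ⋙ realizationFunctor V

end Realization

/-! ### Weak homotopy equivalences -/

section WeakEquivalence

variable {X Y : Type*} [TopologicalSpace X] [TopologicalSpace Y]

/-- The map induced by a continuous map on sets of path components. -/
def mapPathComponents (f : C(X, Y)) : ZerothHomotopy X → ZerothHomotopy Y :=
  Quotient.map f fun _ _ h => Joined.map h f.continuous

/-- The map `π_n(X, x) → π_n(Y, f x)` induced by a continuous map. -/
def mapHomotopyGroup (f : C(X, Y)) (n : ℕ) (x : X) :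
    HomotopyGroup (Fin n) X x → HomotopyGroup (Fin n) Y (f x) :=
  Quotient.map
    (fun p : GenLoop (Fin n) X x => (⟨f.comp p.1, fun y hy => congrArg f (p.2 y hy)⟩ :
      GenLoop (Fin n) Y (f x)))
    fun _ _ h => ContinuousMap.HomotopicRel.comp_continuousMap h f

/-- Weak homotopy equivalences: continuous maps that induce bijections on path components
and on all homotopy groups at all base points. -/
def IsWeakHomotopyEquiv (f : C(X, Y)) : Prop :=
  Function.Bijective (mapPathComponents f) ∧
    ∀ (n : ℕ) (x : X), Function.Bijective (mapHomotopyGroup f (n + 1) x)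

end WeakEquivalence

/-! ### The homotopy interleaving distance -/

section Interleaving

variable {n : ℕ}

/-- An objectwise weak equivalence from `F` to `G` exists. -/
def HasObjectwiseWeakEquiv (F G : Index n ⥤ TopCat.{u}) : Prop :=
  ∃ η : F ⟶ G, ∀ a, IsWeakHomotopyEquiv (η.app a).hom

/-- `F` and `G` are weakly equivalent: they are connected by a finite zigzag of objectwise
weak equivalences. -/
def WeaklyEquivalent (F G : Index n ⥤ TopCat.{u}) : Prop :=
  Relation.EqvGen HasObjectwiseWeakEquiv F G

/-- The diagonal shift `a ↦ a + (δ, …, δ)` of the index poset. -/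
def shift (n : ℕ) (δ : ℝ≥0) : Index n →o Index n where
  toFun a i := a i + δ
  monotone' _ _ h i := add_le_add_left (h i) δ

lemma le_shift_shift (δ : ℝ≥0) (a : Index n) : a ≤ shift n δ (shift n δ a) :=
  fun _ => le_self_add.trans le_self_add

/-- `F` and `G` are (strictly) `δ`-interleaved. -/
def Interleaved (δ : ℝ≥0) (F G : Index n ⥤ TopCat.{u}) : Prop :=
  ∃ (f : F ⟶ (shift n δ).monotone.functor ⋙ G) (g : G ⟶ (shift n δ).monotone.functor ⋙ F),
    (∀ a, f.app a ≫ g.app (shift n δ a) = F.map (homOfLE (le_shift_shift δ a))) ∧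
    (∀ a, g.app a ≫ f.app (shift n δ a) = G.map (homOfLE (le_shift_shift δ a)))

/-- `F` and `G` are `δ`-homotopy-interleaved: they are weakly equivalent to `δ`-interleaved
diagrams of spaces. -/
def HomotopyInterleaved (δ : ℝ≥0) (F G : Index n ⥤ TopCat.{u}) : Prop :=
  ∃ F' G' : Index n ⥤ TopCat.{u},
    WeaklyEquivalent F F' ∧ WeaklyEquivalent G G' ∧ Interleaved δ F' G'

/-- The homotopy interleaving distance. -/
def homotopyInterleavingDist (F G : Index n ⥤ TopCat.{u}) : ℝ≥0∞ :=
  ⨅ (δ : ℝ≥0) (_ : HomotopyInterleaved δ F G), (δ : ℝ≥0∞)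

end Interleaving

end FieldVR

end

noncomputable section

namespace FieldVR

/-! ### Strong deformation retracts are weak homotopy equivalences -/

section Retract

variable {X Y : Type*} [TopologicalSpace X] [TopologicalSpace Y]

/-! Both bounds follow one pattern: up to weak equivalence the two filtrations are put on one common
vertex set, where plain inclusions of subcomplexes interleave them (`interleaved_of_le`), so all
interleaving identities hold strictly.

For the bifiltrations, embeddings at Hausdorff distance below `δ` give vertex maps from `X ⊕ Y` to
`X` and to `Y` whose values are `δ`-close in `Z`. Pulling a complex back along such a retraction
only duplicates vertices, hence is a weak equivalence (`hasObjectwiseWeakEquiv_comapFiltration`).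
Diameters change by at most `2δ` and radii by at most `δ`; since radii are compared with `s / 2`,
both parameters shift by `2δ`.

For the trifiltrations, image and preimage first move both measures to the same `Z`. Thickening by
`δ` then carries the admissible Borel sets of one measure to those of the other at an index shifted
by `2δ`. Two copies of the power set are glued into one preorder, with one copy delayed by `2δ`, so
that thickening is a filtration-preserving reflection onto the undelayed copy
(`hasObjectwiseWeakEquiv_chainFiltration`).

The weak equivalences rest on `homotopicRel_realizationMap`. For a reflection `g` and a chain `A ≤
C`, the vertices `g A` and `C` may be incomparable, so the straight-line homotopy to `g` can leave
the complex. Instead weights are moved one vertex after the other, larger vertices first: a vertex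
`q` not yet fully moved then lies below every vertex `p` that has started, hence below `g p`, and
the support stays a chain. -/

lemma homotopicRel_precomp {Z : Type*} [TopologicalSpace Z] {f g : C(Y, Z)} {S : Set Y}
    (h : f.HomotopicRel g S) (k : C(X, Y)) {T : Set X} (hT : Set.MapsTo k T S) :
    (f.comp k).HomotopicRel (g.comp k) T := by
  obtain ⟨F⟩ := h
  exact ⟨{ toFun := fun p => F (p.1, k p.2)
           continuous_toFun := by fun_prop
           map_zero_left := fun x => F.apply_zero _
           map_one_left := fun x => F.apply_one _
           prop' := fun t x hx => F.eq_fst t (hT hx) }⟩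

/-- The inclusion of a strong deformation retract is a weak homotopy equivalence. -/
theorem isWeakHomotopyEquiv_of_strongDeformationRetract (i : C(X, Y)) (r : C(Y, X))
    (hri : ∀ x, r (i x) = x)
    (h : (ContinuousMap.id Y).HomotopicRel (i.comp r) (Set.range i)) :
    IsWeakHomotopyEquiv i := by
  have hri' : r.comp i = ContinuousMap.id X := ContinuousMap.ext hri
  refine ⟨⟨?_, ?_⟩, fun n x => ⟨?_, ?_⟩⟩
  · rintro ⟨x⟩ ⟨y⟩ hxy
    have h1 : Joined (i x) (i y) := Quotient.exact hxy
    have h2 := Joined.map h1 r.continuous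
    rw [hri, hri] at h2
    exact Quotient.sound h2
  · rintro ⟨y⟩
    refine ⟨Quotient.mk _ (r y), Quotient.sound ?_⟩
    obtain ⟨F⟩ := h
    refine Joined.symm ⟨⟨⟨fun t => F (t, y), by fun_prop⟩, ?_, ?_⟩⟩
    · exact F.apply_zero y
    · exact F.apply_one y
  · rintro ⟨p⟩ ⟨q⟩ hpq
    have h1 : (i.comp p.1).HomotopicRel (i.comp q.1) (Cube.boundary _) := Quotient.exact hpq
    have h2 := h1.comp_continuousMap r
    rw [← ContinuousMap.comp_assoc, ← ContinuousMap.comp_assoc, hri', ContinuousMap.id_comp,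
      ContinuousMap.id_comp] at h2
    exact Quotient.sound h2
  · rintro ⟨p⟩
    let q : GenLoop (Fin (n + 1)) X x :=
      ⟨r.comp p.1, fun y hy => (congrArg r (p.2 y hy)).trans (hri x)⟩
    refine ⟨Quotient.mk _ q, Quotient.sound ?_⟩
    -- The loop sends the boundary of the cube to `i x`, where the deformation is stationary, so the
    -- resulting homotopy is based.
    have h1 := homotopicRel_precomp h p.1 (T := Cube.boundary (Fin (n + 1)))
      (fun y hy => ⟨x, (p.2 y hy).symm⟩)
    exact h1.symm

end Retract

/-! ### Continuity of maps between realizations -/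

section Continuity

variable {V W : Type u}

lemma closedSimplex_nonempty {σ : Finset V} {w : V → ℝ} (h : w ∈ closedSimplex σ) :
    σ.Nonempty := by
  by_contra hσ
  rw [Finset.not_nonempty_iff_eq_empty] at hσ
  have := h.2.2
  simp [hσ] at this

lemma isClosed_closedSimplex (σ : Finset V) : IsClosed (closedSimplex σ) := by
  have : closedSimplex σ = (⋂ v, {w : V → ℝ | 0 ≤ w v}) ∩
      ((⋂ v, ⋂ (_ : v ∉ σ), {w : V → ℝ | w v = 0}) ∩ {w : V → ℝ | ∑ v ∈ σ, w v = 1}) := by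
    ext w
    simp [closedSimplex]
  rw [this]
  refine (isClosed_iInter fun v => isClosed_le (by fun_prop) (by fun_prop)).inter
    ((isClosed_iInter fun v => isClosed_iInter fun _ =>
      isClosed_eq (by fun_prop) (by fun_prop)).inter (isClosed_eq (by fun_prop) (by fun_prop)))

/-- A map into a realization is continuous if its barycentric coordinates are continuous and all
but finitely many of them vanish identically. -/
lemma continuous_of_coordinates {T : Type*} [TopologicalSpace T]
    {K : PreAbstractSimplicialComplex V} (f : T → Realization K) (S : Finset V)
    (hf : ∀ v, Continuous fun t => (f t).1 v) (hS : ∀ t, ∀ v, v ∉ S → (f t).1 v = 0) :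
    Continuous f := by
  classical
  have hc : Continuous fun t => (f t).1 := continuous_pi hf
  let ι := {τ : Finset V // τ ∈ S.powerset ∧ τ ∈ K.faces}
  have : Finite ι := Set.Finite.subset (S.powerset.finite_toSet) fun τ h => h.1
  have hcl : ∀ τ : ι, IsClosed {t | (f t).1 ∈ closedSimplex τ.1} := fun τ =>
    (isClosed_closedSimplex τ.1).preimage hc
  refine (locallyFinite_of_finite (fun τ : ι => {t | (f t).1 ∈ closedSimplex τ.1})).continuous
    ?_ hcl ?_
  · rw [Set.eq_univ_iff_forall]
    intro t
    obtain ⟨σ, hσ, hw⟩ := (f t).2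
    -- Discarding the vanishing coordinates puts every value in a simplex with vertices in `S`;
    -- there are finitely many of these, and they form a finite closed cover.
    have hw' : (f t).1 ∈ closedSimplex (σ ∩ S) := by
      refine ⟨hw.1, fun v hv => ?_, ?_⟩
      · by_cases h : v ∈ S
        · exact hw.2.1 v fun h' => hv (Finset.mem_inter.2 ⟨h', h⟩)
        · exact hS t v h
      · rw [← hw.2.2]
        refine Finset.sum_subset Finset.inter_subset_left fun v hv hv' => hS t v fun h => ?_
        exact hv' (Finset.mem_inter.2 ⟨hv, h⟩)
    exact Set.mem_iUnion.2 ⟨⟨σ ∩ S, Finset.mem_powerset.2 Finset.inter_subset_right,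
      (K.isRelLowerSet_faces hσ).2 Finset.inter_subset_left (closedSimplex_nonempty hw')⟩, hw'⟩
  · intro τ
    rw [continuousOn_iff_continuous_domRestrict]
    have h2 : Continuous fun t : {t | (f t).1 ∈ closedSimplex τ.1} =>
        simplexInclusion K ⟨τ.1, τ.2.2⟩ ⟨(f t.1).1, t.2⟩ :=
      (continuous_simplexInclusion K _).comp
        ((hc.comp continuous_subtype_val).subtype_mk fun t => t.2)
    exact h2

/-- A map on the product of a realization with the unit interval is continuous if its
restrictions to the prisms over the closed simplices are. -/
lemma continuous_prod_unitInterval {K : PreAbstractSimplicialComplex V} {Z : Type*}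
    [TopologicalSpace Z] (G : unitInterval × Realization K → Z)
    (h : ∀ σ : K.faces, Continuous fun p : closedSimplex (σ : Finset V) × unitInterval =>
      G (p.2, simplexInclusion K σ p.1)) : Continuous G := by
  have hx : ∀ x, Continuous fun t => G (t, x) := by
    rintro ⟨w, σ, hσ, hw⟩
    exact (h ⟨σ, hσ⟩).comp (Continuous.prodMk_right (⟨w, hw⟩ : closedSimplex σ))
  -- Currying reduces continuity to the individual simplices; uncurrying is allowed because the
  -- interval is locally compact.
  let F : Realization K → C(unitInterval, Z) := fun x => ⟨fun t => G (t, x), hx x⟩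
  have hF : Continuous F := continuous_realization_iff.2 fun σ =>
    (ContinuousMap.curry ⟨_, h σ⟩).continuous
  have h2 : Continuous fun p : Realization K × unitInterval => F p.1 p.2 :=
    ContinuousMap.continuous_uncurry_of_continuous ⟨F, hF⟩
  exact h2.comp continuous_swap

end Continuity

/-! ### Push-forward of barycentric coordinates and simplicial maps -/

section Simplicial

variable {V W : Type u}

/-- The total weight of a set of vertices. -/
def weight (w : V → ℝ) (A : Set V) : ℝ := ∑ᶠ q, A.indicator w q

lemma weight_eq_sum {w : V → ℝ} {σ : Finset V} (h : ∀ v, v ∉ σ → w v = 0) (A : Set V) :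
    weight w A = ∑ q ∈ σ, A.indicator w q := by
  refine finsum_eq_sum_of_support_subset _ fun q hq => ?_
  by_contra hqσ
  refine hq ?_
  by_cases hA : q ∈ A
  · rw [Set.indicator_of_mem hA, h q hqσ]
  · rw [Set.indicator_of_notMem hA]

lemma weight_nonneg {w : V → ℝ} (h : ∀ v, 0 ≤ w v) (A : Set V) : 0 ≤ weight w A :=
  finsum_nonneg fun q => Set.indicator_nonneg (fun v _ => h v) q

/-- The push-forward of barycentric coordinates along a map of vertices. -/
def pushforward (φ : V → W) (w : V → ℝ) (v : W) : ℝ := weight w (φ ⁻¹' {v})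

lemma pushforward_nonneg (φ : V → W) {w : V → ℝ} (h : ∀ v, 0 ≤ w v) (v : W) :
    0 ≤ pushforward φ w v := weight_nonneg h _

lemma pushforward_eq_sum [DecidableEq W] (φ : V → W) {w : V → ℝ} {σ : Finset V}
    (h : ∀ v, v ∉ σ → w v = 0) (v : W) :
    pushforward φ w v = ∑ q ∈ σ, if φ q = v then w q else 0 := by
  rw [pushforward, weight_eq_sum h]
  refine Finset.sum_congr rfl fun q _ => ?_
  by_cases hq : φ q = v <;> simp [hq]

lemma pushforward_eq_zero [DecidableEq W] (φ : V → W) {w : V → ℝ} {σ : Finset V}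
    (h : ∀ v, v ∉ σ → w v = 0) {v : W} (hv : v ∉ σ.image φ) : pushforward φ w v = 0 := by
  rw [pushforward_eq_sum φ h]
  refine Finset.sum_eq_zero fun q hq => if_neg fun hqv => hv ?_
  exact hqv ▸ Finset.mem_image_of_mem φ hq

lemma sum_pushforward [DecidableEq W] (φ : V → W) {w : V → ℝ} {σ : Finset V} {T : Finset W}
    (h : ∀ v, v ∉ σ → w v = 0) (hT : σ.image φ ⊆ T) :
    ∑ v ∈ T, pushforward φ w v = ∑ q ∈ σ, w q := by
  simp_rw [pushforward_eq_sum φ h]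
  rw [Finset.sum_comm]
  refine Finset.sum_congr rfl fun q hq => ?_
  rw [Finset.sum_ite_eq, if_pos (hT (Finset.mem_image_of_mem φ hq))]

lemma pushforward_mem_closedSimplex [DecidableEq W] (φ : V → W) {w : V → ℝ} {σ : Finset V}
    (h : w ∈ closedSimplex σ) : pushforward φ w ∈ closedSimplex (σ.image φ) :=
  ⟨pushforward_nonneg φ h.1, fun _ => pushforward_eq_zero φ h.2.1,
    (sum_pushforward φ h.2.1 subset_rfl).trans h.2.2⟩

lemma pushforward_comp {U : Type u} (ψ : W → U) (φ : V → W) {w : V → ℝ} {σ : Finset V}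
    (h : ∀ v, v ∉ σ → w v = 0) :
    pushforward ψ (pushforward φ w) = pushforward (ψ ∘ φ) w := by
  classical
  ext u
  rw [pushforward_eq_sum ψ (fun v => pushforward_eq_zero φ h), pushforward_eq_sum _ h]
  have : ∀ v : W, (if ψ v = u then pushforward φ w v else 0) =
      ∑ q ∈ σ, if φ q = v then (if ψ v = u then w q else 0) else 0 := fun v => by
    rw [pushforward_eq_sum φ h]
    split_ifs <;> simp
  simp_rw [this]
  rw [Finset.sum_comm]
  refine Finset.sum_congr rfl fun q hq => ?_
  rw [Finset.sum_ite_eq, if_pos (Finset.mem_image_of_mem φ hq)]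
  rfl

/-- A fixed vertex map acts trivially on barycentric coordinates. -/
lemma pushforward_eq_self {g : V → V} {w : V → ℝ} (hg : ∀ v, w v ≠ 0 → g v = v) :
    pushforward g w = w := by
  ext v
  rw [pushforward, weight, finsum_eq_single _ v]
  · by_cases hv : w v = 0
    · simp [hv]
    · exact Set.indicator_of_mem (show v ∈ g ⁻¹' {v} from hg v hv) w
  · intro q hq
    by_cases hw : w q = 0
    · simp [hw]
    · exact Set.indicator_of_notMem (show q ∉ g ⁻¹' {v} from
        fun h => hq ((hg q hw).symm.trans h)) w

/-- The map of realizations induced by a simplicial map. -/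
def realizationMap [DecidableEq W] {K : PreAbstractSimplicialComplex V}
    {L : PreAbstractSimplicialComplex W} (φ : V → W)
    (h : ∀ σ ∈ K.faces, σ.image φ ∈ L.faces) : C(Realization K, Realization L) where
  toFun w := ⟨pushforward φ w.1, by
    obtain ⟨w, σ, hσ, hw⟩ := w
    exact ⟨_, h σ hσ, pushforward_mem_closedSimplex φ hw⟩⟩
  continuous_toFun := continuous_realization_iff.2 fun σ => by
    refine continuous_of_coordinates _ (σ.1.image φ) (fun v => ?_) fun w v =>
      pushforward_eq_zero φ w.2.2.1
    have : (fun w : closedSimplex σ.1 => pushforward φ w.1 v) =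
        fun w => ∑ q ∈ σ.1, if φ q = v then w.1 q else 0 :=
      funext fun w => pushforward_eq_sum φ w.2.2.1 v
    change Continuous fun w : closedSimplex σ.1 => pushforward φ w.1 v
    rw [this]
    refine continuous_finsetSum _ fun q _ => ?_
    split_ifs
    · exact (continuous_apply q).comp continuous_subtype_val
    · exact continuous_const

end Simplicial

/-! ### Flows along vertex maps -/

section Flow

variable {V : Type u}

/-- The part of the weight of the vertex `p` that has been moved at time `t`, when the weights of
the vertices are moved one after the other: `p` starts moving after all `q` with `R q p`. -/
def movedWeight (R : V → V → Prop) (t : ℝ) (w : V → ℝ) (p : V) : ℝ :=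
  max 0 (min (w p) (t - weight w {q | R q p}))

/-- The flow that moves the weights from the vertices `p` to the vertices `g p`. -/
def flow (R : V → V → Prop) (g : V → V) (t : ℝ) (w : V → ℝ) (v : V) : ℝ :=
  w v - movedWeight R t w v + pushforward g (movedWeight R t w) v

variable {R : V → V → Prop} {g : V → V} {t : ℝ} {w : V → ℝ} {σ : Finset V}

lemma movedWeight_nonneg (p : V) : 0 ≤ movedWeight R t w p := le_max_left _ _

lemma movedWeight_le (h : ∀ v, 0 ≤ w v) (p : V) : movedWeight R t w p ≤ w p :=
  max_le (h p) (min_le_left _ _)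

lemma movedWeight_eq_zero {p : V} (h : w p = 0) : movedWeight R t w p = 0 := by
  rw [movedWeight, h]
  exact max_eq_left (min_le_left _ _)

lemma movedWeight_zero (h : ∀ v, 0 ≤ w v) : movedWeight R 0 w = 0 := by
  ext p
  refine max_eq_left ((min_le_right _ _).trans ?_)
  have := weight_nonneg h {q | R q p}
  linarith

/-- The weights of a vertex and of its predecessors. -/
lemma add_weight_le (hσ : ∀ v, v ∉ σ → w v = 0) (h : ∀ v, 0 ≤ w v) {q : V} {A B : Set V}
    (hq : q ∉ A) (hqB : q ∈ B) (hAB : A ⊆ B) : w q + weight w A ≤ weight w B := by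
  classical
  rw [weight_eq_sum hσ, weight_eq_sum hσ]
  by_cases hqσ : q ∈ σ
  · rw [← Finset.add_sum_erase σ _ hqσ, ← Finset.add_sum_erase σ (fun x => B.indicator w x) hqσ,
      Set.indicator_of_notMem hq, Set.indicator_of_mem hqB, zero_add]
    exact add_le_add_right (Finset.sum_le_sum fun x _ =>
      Set.indicator_le_indicator_of_subset hAB h x) _
  · rw [hσ q hqσ, zero_add]
    exact Finset.sum_le_sum fun x _ => Set.indicator_le_indicator_of_subset hAB h x

/-- The vertex `p` needs the time span from the weight of its predecessors to that weight plus `w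
p`, and this ends by the total weight `1`. -/
lemma movedWeight_one (hR : ∀ v, ¬ R v v) (hw : w ∈ closedSimplex σ) :
    movedWeight R 1 w = w := by
  ext p
  have h1 : w p + weight w {q | R q p} ≤ weight w Set.univ :=
    add_weight_le hw.2.1 hw.1 (hR p) (Set.mem_univ _) (Set.subset_univ _)
  have h2 : weight w Set.univ = 1 := by
    rw [weight_eq_sum hw.2.1, Set.indicator_univ, hw.2.2]
  rw [movedWeight, min_eq_left (by linarith), max_eq_right (hw.1 p)]

/-- A vertex starts moving only after its predecessors have been moved. -/
lemma movedWeight_eq_of_pos (hR : ∀ v, ¬ R v v) (hT : ∀ a b c, R a b → R b c → R a c)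
    (hσ : ∀ v, v ∉ σ → w v = 0) (h : ∀ v, 0 ≤ w v) {p q : V} (hqp : R q p)
    (hp : 0 < movedWeight R t w p) : movedWeight R t w q = w q := by
  have h1 : w q + weight w {x | R x q} ≤ weight w {x | R x p} :=
    add_weight_le hσ h (hR q) hqp fun x hx => hT _ _ _ hx hqp
  have h2 : 0 < t - weight w {x | R x p} := by
    by_contra hneg
    exact hp.ne' (max_eq_left ((min_le_right _ _).trans (not_lt.1 hneg)))
  rw [movedWeight, min_eq_left (by linarith), max_eq_right (h q)]

lemma flow_eq_zero [DecidableEq V] (hσ : ∀ v, v ∉ σ → w v = 0) {v : V}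
    (hv : v ∉ σ ∪ σ.image g) : flow R g t w v = 0 := by
  rw [Finset.notMem_union] at hv
  rw [flow, hσ v hv.1, movedWeight_eq_zero (hσ v hv.1),
    pushforward_eq_zero g (fun v hv => movedWeight_eq_zero (hσ v hv)) hv.2]
  simp

lemma flow_mem_closedSimplex [DecidableEq V] (hw : w ∈ closedSimplex σ)
    {τ υ : Finset V} (hτ : ∀ v, movedWeight R t w v < w v → v ∈ τ)
    (hυ : ∀ v, 0 < movedWeight R t w v → v ∈ υ) :
    flow R g t w ∈ closedSimplex (τ ∪ υ.image g) := by
  have hm : ∀ v, v ∉ υ → movedWeight R t w v = 0 := fun v hv =>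
    le_antisymm (not_lt.1 fun h => hv (hυ v h)) (movedWeight_nonneg v)
  have hm' : ∀ v, v ∉ τ → movedWeight R t w v = w v := fun v hv =>
    le_antisymm (movedWeight_le hw.1 v) (not_lt.1 fun h => hv (hτ v h))
  have hmσ : ∀ v, v ∉ σ → movedWeight R t w v = 0 := fun v hv =>
    movedWeight_eq_zero (hw.2.1 v hv)
  have hz : ∀ v, v ∉ τ ∪ υ.image g → flow R g t w v = 0 := fun v hv => by
    rw [Finset.notMem_union] at hv
    rw [flow, hm' v hv.1, pushforward_eq_zero g hm hv.2]
    simp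
  refine ⟨fun v => add_nonneg (sub_nonneg.2 (movedWeight_le hw.1 v))
    (pushforward_nonneg g movedWeight_nonneg v), hz, ?_⟩
  have hz' : ∀ v, v ∉ σ ∪ σ.image g → flow R g t w v = 0 := fun v => flow_eq_zero hw.2.1
  -- The total weight does not depend on the finite set containing the support; on `σ ∪ σ.image g`
  -- the removed and the added weights visibly cancel.
  have e1 : ∑ v ∈ τ ∪ υ.image g, flow R g t w v = ∑ᶠ v, flow R g t w v :=
    (finsum_eq_sum_of_support_subset _ fun v hv => by_contra fun h => hv (hz v h)).symm
  have e2 : ∑ᶠ v, flow R g t w v = ∑ v ∈ σ ∪ σ.image g, flow R g t w v :=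
    finsum_eq_sum_of_support_subset _ fun v hv => by_contra fun h => hv (hz' v h)
  rw [e1, e2]
  simp only [flow]
  rw [Finset.sum_add_distrib, sum_pushforward g hmσ Finset.subset_union_right,
    ← Finset.sum_subset (Finset.subset_union_left (s₁ := σ) (s₂ := σ.image g)),
    ← Finset.sum_add_distrib]
  · simp [hw.2.2]
  · intro v _ hv
    rw [hw.2.1 v hv, hmσ v hv, sub_zero]

/-- The cut condition for the flow along a vertex map `g`: if the vertices of `υ` can have started
moving while the vertices of `τ` have not been moved completely, then `τ ∪ g(υ)` spans a face. -/
def FlowCompatible [DecidableEq V] (K : PreAbstractSimplicialComplex V) (R : V → V → Prop)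
    (g : V → V) : Prop :=
  ∀ σ ∈ K.faces, ∀ τ ⊆ σ, ∀ υ ⊆ σ, (∀ q ∈ τ, ∀ p ∈ υ, ¬ R q p) →
    (τ ∪ υ.image g).Nonempty → τ ∪ υ.image g ∈ K.faces

lemma FlowCompatible.image_mem [DecidableEq V] {K : PreAbstractSimplicialComplex V}
    (hK : FlowCompatible K R g) (σ : Finset V) (hσ : σ ∈ K.faces) : σ.image g ∈ K.faces := by
  have := hK σ hσ ∅ (Finset.empty_subset _) σ subset_rfl (by simp)
    (by simpa using (K.isRelLowerSet_faces hσ).1)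
  simpa using this

lemma FlowCompatible.flow_mem [DecidableEq V] {K : PreAbstractSimplicialComplex V}
    (hK : FlowCompatible K R g) (hR : ∀ v, ¬ R v v) (hT : ∀ a b c, R a b → R b c → R a c)
    (t : ℝ) (w : Realization K) : ∃ σ ∈ K.faces, flow R g t w.1 ∈ closedSimplex σ := by
  obtain ⟨w, σ, hσ, hw⟩ := w
  have hmem := flow_mem_closedSimplex (R := R) (g := g) (t := t) hw
    (τ := σ.filter fun v => movedWeight R t w v < w v)
    (υ := σ.filter fun v => 0 < movedWeight R t w v) (fun v hv => by
      refine Finset.mem_filter.2 ⟨by_contra fun h => ?_, hv⟩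
      rw [movedWeight_eq_zero (hw.2.1 v h), hw.2.1 v h] at hv
      exact lt_irrefl _ hv) (fun v hv => by
      refine Finset.mem_filter.2 ⟨by_contra fun h => ?_, hv⟩
      rw [movedWeight_eq_zero (hw.2.1 v h)] at hv
      exact lt_irrefl _ hv)
  refine ⟨_, hK σ hσ _ (Finset.filter_subset _ _) _ (Finset.filter_subset _ _) ?_
    (closedSimplex_nonempty hmem), hmem⟩
  intro q hq p hp hqp
  exact (Finset.mem_filter.1 hq).2.ne
    (movedWeight_eq_of_pos hR hT hw.2.1 hw.1 hqp (Finset.mem_filter.1 hp).2)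

lemma continuous_movedWeight (σ : Finset V) (p : V) :
    Continuous fun x : closedSimplex σ × unitInterval => movedWeight R x.2 x.1.1 p := by
  have h : ∀ q : V, Continuous fun x : closedSimplex σ × unitInterval => x.1.1 q := fun q =>
    (continuous_apply q).comp (continuous_subtype_val.comp continuous_fst)
  have h2 : Continuous fun x : closedSimplex σ × unitInterval => weight x.1.1 {q | R q p} := by
    have : (fun x : closedSimplex σ × unitInterval => weight x.1.1 {q | R q p}) =
        fun x => ∑ q ∈ σ, {q | R q p}.indicator x.1.1 q :=
      funext fun x => weight_eq_sum x.1.2.2.1 _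
    rw [this]
    refine continuous_finsetSum _ fun q _ => ?_
    by_cases hq : R q p
    · simpa [Set.indicator_apply, hq] using h q
    · simpa [Set.indicator_apply, hq] using continuous_const
  have h3 := h p
  unfold movedWeight
  fun_prop

lemma continuous_flow (σ : Finset V) (v : V) :
    Continuous fun x : closedSimplex σ × unitInterval => flow R g x.2 x.1.1 v := by
  classical
  have h1 : Continuous fun x : closedSimplex σ × unitInterval => x.1.1 v :=
    (continuous_apply v).comp (continuous_subtype_val.comp continuous_fst)
  have h2 : Continuous fun x : closedSimplex σ × unitInterval =>
      pushforward g (movedWeight R x.2 x.1.1) v := by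
    have : (fun x : closedSimplex σ × unitInterval =>
        pushforward g (movedWeight R x.2 x.1.1) v) =
        fun x => ∑ q ∈ σ, if g q = v then movedWeight R x.2 x.1.1 q else 0 :=
      funext fun x => pushforward_eq_sum g
        (fun v hv => movedWeight_eq_zero (x.1.2.2.1 v hv)) v
    rw [this]
    refine continuous_finsetSum _ fun q _ => ?_
    split_ifs
    · exact continuous_movedWeight σ q
    · exact continuous_const
  exact (h1.sub (continuous_movedWeight σ v)).add h2

/-- A vertex map that satisfies the cut condition for a strict order induces a map homotopic to
the identity, relative to the points supported on fixed vertices. -/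
theorem homotopicRel_realizationMap [DecidableEq V] {K : PreAbstractSimplicialComplex V}
    (hK : FlowCompatible K R g) (hR : ∀ v, ¬ R v v) (hT : ∀ a b c, R a b → R b c → R a c) :
    (ContinuousMap.id (Realization K)).HomotopicRel (realizationMap g hK.image_mem)
      {w | ∀ v, w.1 v ≠ 0 → g v = v} := by
  let H : unitInterval × Realization K → Realization K := fun x =>
    ⟨flow R g x.1 x.2.1, hK.flow_mem hR hT x.1 x.2⟩
  have hH : Continuous H := continuous_prod_unitInterval H fun σ =>
    continuous_of_coordinates _ (σ.1 ∪ σ.1.image g) (fun v => continuous_flow σ.1 v)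
      fun x v hv => flow_eq_zero x.1.2.2.1 hv
  refine ⟨{ toFun := H, continuous_toFun := hH, map_zero_left := ?_, map_one_left := ?_,
            prop' := ?_ }⟩
  · rintro ⟨w, σ, hσ, hw⟩
    refine Subtype.ext (funext fun v => ?_)
    change flow R g 0 w v = w v
    rw [flow, movedWeight_zero hw.1]
    simp [pushforward, weight]
  · rintro ⟨w, σ, hσ, hw⟩
    refine Subtype.ext (funext fun v => ?_)
    change flow R g 1 w v = pushforward g w v
    rw [flow, movedWeight_one hR hw, sub_self, zero_add]
  · rintro t ⟨w, σ, hσ, hw⟩ hfix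
    refine Subtype.ext (funext fun v => ?_)
    change flow R g t w v = w v
    -- Weight is moved only from vertices in the support of `w`, all fixed by `g`, so it returns to
    -- where it was taken.
    rw [flow, pushforward_eq_self, sub_add_cancel]
    exact fun v hv => hfix v fun h => hv (movedWeight_eq_zero h)

end Flow

/-! ### Retractions of filtrations -/

section Filtration

variable {V W : Type u} {n : ℕ}

lemma realizationMap_comp_apply {U : Type u} [DecidableEq V] [DecidableEq W] [DecidableEq U]
    {K : PreAbstractSimplicialComplex V} {L : PreAbstractSimplicialComplex W}
    {M : PreAbstractSimplicialComplex U} {φ : V → W} {ψ : W → U}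
    (hφ : ∀ σ ∈ K.faces, σ.image φ ∈ L.faces) (hψ : ∀ σ ∈ L.faces, σ.image ψ ∈ M.faces)
    (w : Realization K) :
    (realizationMap ψ hψ (realizationMap φ hφ w)).1 = pushforward (ψ ∘ φ) w.1 := by
  obtain ⟨w, σ, hσ, hw⟩ := w
  exact pushforward_comp ψ φ hw.2.1

/-- A filtration with a vertex retraction onto a subfiltration, such that the retraction satisfies
the cut condition, is objectwise weakly equivalent to the subfiltration. -/
theorem hasObjectwiseWeakEquiv_of_retraction [DecidableEq V] [DecidableEq W]
    (K : Index n →o PreAbstractSimplicialComplex V)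
    (L : Index n →o PreAbstractSimplicialComplex W) (i : V → W) (r : W → V)
    (hri : ∀ v, r (i v) = v) (hi : ∀ a, ∀ σ ∈ (K a).faces, σ.image i ∈ (L a).faces)
    (hr : ∀ a, ∀ σ ∈ (L a).faces, σ.image r ∈ (K a).faces) (R : W → W → Prop)
    (hR : ∀ v, ¬ R v v) (hT : ∀ a b c, R a b → R b c → R a c)
    (hL : ∀ a, FlowCompatible (L a) R (i ∘ r)) :
    HasObjectwiseWeakEquiv (filtrationDiagram K) (filtrationDiagram L) := by
  refine ⟨{ app := fun a => TopCat.ofHom (realizationMap i (hi a)), naturality := ?_ }, ?_⟩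
  · intro a b h
    rfl
  · intro a
    refine isWeakHomotopyEquiv_of_strongDeformationRetract (realizationMap i (hi a))
      (realizationMap r (hr a)) ?_ ?_
    · intro w
      refine Subtype.ext ?_
      rw [realizationMap_comp_apply]
      exact pushforward_eq_self fun v _ => hri v
    · have h := homotopicRel_realizationMap (hL a) hR hT
      have e : realizationMap (i ∘ r) (hL a).image_mem =
          (realizationMap i (hi a)).comp (realizationMap r (hr a)) := by
        ext w : 1
        exact Subtype.ext (realizationMap_comp_apply (hr a) (hi a) w).symm
      rw [e] at h
      obtain ⟨F⟩ := h
      -- Points in the image of `i` are supported on vertices `i q`, which `i ∘ r` fixes.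
      refine ⟨{ toHomotopy := F.toHomotopy, prop' := fun t x hx => F.prop t x ?_ }⟩
      obtain ⟨⟨w, σ, hσ, hw⟩, rfl⟩ := hx
      intro v hv
      have hv' : v ∈ σ.image i := by
        by_contra h
        exact hv (pushforward_eq_zero i hw.2.1 h)
      obtain ⟨q, -, rfl⟩ := Finset.mem_image.1 hv'
      exact congrArg i (hri q)

/-- Filtrations on the same vertices that are interleaved by inclusions. -/
theorem interleaved_of_le (K L : Index n →o PreAbstractSimplicialComplex V) (δ : ℝ≥0)
    (hKL : ∀ a, K a ≤ L (shift n δ a)) (hLK : ∀ a, L a ≤ K (shift n δ a)) :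
    Interleaved δ (filtrationDiagram K) (filtrationDiagram L) :=
  ⟨{ app := fun a => (realizationFunctor V).map (homOfLE (hKL a)), naturality := fun _ _ _ => rfl },
   { app := fun a => (realizationFunctor V).map (homOfLE (hLK a)), naturality := fun _ _ _ => rfl },
   fun _ => rfl, fun _ => rfl⟩

/-! ### Pull-backs of filtrations along vertex retractions -/

/-- The pull-back of a complex along a map of vertices. -/
def comapComplex [DecidableEq V] (r : W → V) (K : PreAbstractSimplicialComplex V) :
    PreAbstractSimplicialComplex W where
  faces := {σ | σ.image r ∈ K.faces}
  isRelLowerSet_faces := fun _ hσ => ⟨Finset.image_nonempty.1 (K.isRelLowerSet_faces hσ).1,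
    fun _ hτσ hτ => (K.isRelLowerSet_faces hσ).2 (Finset.image_subset_image hτσ)
      (Finset.image_nonempty.2 hτ)⟩

/-- The pull-back of a filtration along a map of vertices. -/
def comapFiltration [DecidableEq V] (r : W → V) (K : Index n →o PreAbstractSimplicialComplex V) :
    Index n →o PreAbstractSimplicialComplex W where
  toFun a := comapComplex r (K a)
  monotone' _ _ hab _ hσ := K.monotone hab hσ

/-- As `r ∘ (i ∘ r) = r`, adding the vertices `i (r p)` to a face does not change its image under
`r`. No order is needed, so `R` is empty and all vertices start moving at once. -/
theorem hasObjectwiseWeakEquiv_comapFiltration [DecidableEq V] [DecidableEq W]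
    (K : Index n →o PreAbstractSimplicialComplex V) (i : V → W) (r : W → V)
    (hri : ∀ v, r (i v) = v) :
    HasObjectwiseWeakEquiv (filtrationDiagram K) (filtrationDiagram (comapFiltration r K)) := by
  refine hasObjectwiseWeakEquiv_of_retraction K _ i r hri ?_ (fun _ _ h => h)
    (fun _ _ => False) (fun _ h => h) (fun _ _ _ h => h.elim) ?_
  · intro a σ hσ
    change (σ.image i).image r ∈ (K a).faces
    rw [Finset.image_image]
    have : σ.image (r ∘ i) = σ := by
      conv_rhs => rw [← Finset.image_id (s := σ)]
      exact Finset.image_congr fun v _ => hri v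
    rwa [this]
  · intro a σ hσ τ hτ υ hυ _ hne
    refine ((K a).isRelLowerSet_faces hσ).2 ?_ (Finset.image_nonempty.2 hne)
    rw [Finset.image_union, Finset.image_image]
    refine Finset.union_subset (Finset.image_subset_image hτ) ?_
    intro v hv
    obtain ⟨p, hp, rfl⟩ := Finset.mem_image.1 hv
    simp only [Function.comp_apply, hri]
    exact Finset.mem_image_of_mem r (hυ hp)

/-! ### Chains in filtered preorders -/

/-- The filtration by finite chains of a relation, with vertices in a filtration by sets. -/
def chainFiltration (E : V → V → Prop) (S : Index n → Set V) (hS : Monotone S) :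
    Index n →o PreAbstractSimplicialComplex V where
  toFun a :=
    { faces := {σ | σ.Nonempty ∧ IsChain E (σ : Set V) ∧ ∀ v ∈ σ, v ∈ S a}
      isRelLowerSet_faces := fun _ hσ => ⟨hσ.1, fun _ hτσ hτ =>
        ⟨hτ, hσ.2.1.mono (Finset.coe_subset.2 hτσ), fun v hv => hσ.2.2 v (hτσ hv)⟩⟩ }
  monotone' _ _ hab _ hσ := ⟨hσ.1, hσ.2.1, fun v hv => hS hab (hσ.2.2 v hv)⟩

/-- The chains of a filtered preordered set are weakly equivalent to those of a reflective
sub-preorder. -/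
theorem hasObjectwiseWeakEquiv_chainFiltration (D : V → V → Prop) (E : W → W → Prop)
    (hErefl : ∀ w, E w w) (hEtrans : ∀ a b c, E a b → E b c → E a c)
    {S : Index n → Set V} (hS : Monotone S) {T : Index n → Set W} (hT : Monotone T)
    (i : V → W) (r : W → V) (hri : ∀ v, r (i v) = v)
    (hi : ∀ v v', D v v' → E (i v) (i v')) (hr : ∀ w w', E w w' → D (r w) (r w'))
    (hir : ∀ w, E w (i (r w))) (hiS : ∀ a, ∀ v ∈ S a, i v ∈ T a)
    (hrT : ∀ a, ∀ w ∈ T a, r w ∈ S a) :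
    HasObjectwiseWeakEquiv (filtrationDiagram (chainFiltration D S hS))
      (filtrationDiagram (chainFiltration E T hT)) := by
  classical
  refine hasObjectwiseWeakEquiv_of_retraction _ _ i r hri ?_ ?_ (fun a b => E b a ∧ ¬ E a b)
    (fun v h => h.2 h.1) (fun a b c h h' => ⟨hEtrans _ _ _ h'.1 h.1, fun hac =>
      h.2 (hEtrans _ _ _ hac h'.1)⟩) ?_
  · rintro a σ ⟨h1, h2, h3⟩
    refine ⟨h1.image i, ?_, ?_⟩
    · rw [Finset.coe_image]
      exact h2.image_of_map_rel _ _ i hi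
    · intro w hw
      obtain ⟨v, hv, rfl⟩ := Finset.mem_image.1 hw
      exact hiS a v (h3 v hv)
  · rintro a σ ⟨h1, h2, h3⟩
    refine ⟨h1.image r, ?_, ?_⟩
    · rw [Finset.coe_image]
      exact h2.image_of_map_rel _ _ r hr
    · intro w hw
      obtain ⟨v, hv, rfl⟩ := Finset.mem_image.1 hw
      exact hrT a v (h3 v hv)
  · rintro a σ ⟨h1, h2, h3⟩ τ hτ υ hυ hcut hne
    have htot : ∀ x ∈ σ, ∀ y ∈ σ, E x y ∨ E y x := fun x hx y hy => by
      by_cases hxy : x = y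
      · exact Or.inl (hxy ▸ hErefl x)
      · exact h2 hx hy hxy
    -- The cut condition says that `q` is not strictly above `p`; comparability in `σ` gives `E q
    -- p`, and `p` lies below its reflection.
    have hmix : ∀ q ∈ τ, ∀ p ∈ υ, E q (i (r p)) := fun q hq p hp => by
      refine hEtrans _ _ _ ?_ (hir p)
      by_contra hqp
      exact hcut q hq p hp ⟨(htot q (hτ hq) p (hυ hp)).resolve_left hqp, hqp⟩
    refine ⟨hne, ?_, ?_⟩
    · intro x hx y hy _
      simp only [Finset.coe_union, Finset.coe_image, Set.mem_union, Finset.mem_coe, Set.mem_image,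
        Function.comp_apply] at hx hy
      rcases hx with hx | ⟨p, hp, rfl⟩ <;> rcases hy with hy | ⟨p', hp', rfl⟩
      · exact htot x (hτ hx) y (hτ hy)
      · exact Or.inl (hmix x hx p' hp')
      · exact Or.inr (hmix y hy p hp)
      · exact (htot p (hυ hp) p' (hυ hp')).imp (fun h => hi _ _ (hr _ _ h))
          fun h => hi _ _ (hr _ _ h)
    · intro x hx
      rcases Finset.mem_union.1 hx with hx | hx
      · exact h3 x (hτ hx)
      · obtain ⟨p, hp, rfl⟩ := Finset.mem_image.1 hx
        exact hiS a _ (hrT a _ (h3 p (hυ hp)))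

lemma chainFiltration_flip (E : V → V → Prop) {S : Index n → Set V} (hS : Monotone S) :
    chainFiltration (flip E) S hS = chainFiltration E S hS := by
  ext a σ
  have : IsChain (flip E) (σ : Set V) ↔ IsChain E (σ : Set V) :=
    ⟨fun h => h.symm, fun h => h.symm⟩
  change (_ ∧ _ ∧ _) ↔ (_ ∧ _ ∧ _)
  rw [this]

end Filtration

/-! ### Comparison of the Vietoris-Rips filtrations -/

section Comparison

variable {B : Type v} [MetricSpace B]

/-! ### Bifiltrations and the Hausdorff distance -/

lemma radius_le_add {C D : Set B} {δ : ℝ≥0∞} (h : ∀ d ∈ D, ∃ c ∈ C, edist c d ≤ δ) :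
    radius D ≤ radius C + δ := by
  rw [radius, radius, ENNReal.iInf_add]
  refine le_iInf fun b => iInf_le_of_le b (iSup₂_le fun d hd => ?_)
  obtain ⟨c, hc, hcd⟩ := h d hd
  exact (edist_triangle b c d).trans
    (add_le_add (le_iSup₂ (f := fun c (_ : c ∈ C) => edist b c) c hc) hcd)

lemma coe_div_two_add (s δ : ℝ≥0) :
    (s : ℝ≥0∞) / 2 + δ = ((s + 2 * δ : ℝ≥0) : ℝ≥0∞) / 2 := by
  rw [ENNReal.coe_add, ENNReal.coe_mul, ENNReal.add_div, ENNReal.coe_ofNat,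
    mul_comm, ENNReal.mul_div_cancel_right two_ne_zero ENNReal.ofNat_ne_top]

lemma BField.edist_proj_le (Z : BField.{u, v} B) (x y : Z) :
    edist (Z.proj x) (Z.proj y) ≤ edist x y := by
  simpa using Z.lipschitz x y

lemma comapFiltration_ripsBifiltration_le {X Y Z : BField.{u, v} B} (φ : BFieldEmbedding X Z)
    (ψ : BFieldEmbedding Y Z) [DecidableEq X] [DecidableEq Y] {W : Type u} (r : W → X) (r' : W → Y)
    {δ : ℝ≥0} (h : ∀ w, edist (φ.toFun (r w)) (ψ.toFun (r' w)) ≤ δ) (a : Index 2) :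
    comapFiltration r (ripsBifiltration X) a ≤
      comapFiltration r' (ripsBifiltration Y) (shift 2 (2 * δ) a) := by
  rintro σ ⟨h1, h2, h3⟩
  refine ⟨Finset.image_nonempty.2 (Finset.image_nonempty.1 h1), ?_, ?_⟩
  · change _ ≤ ((a 0 + 2 * δ : ℝ≥0) : ℝ≥0∞)
    refine Metric.ediam_le fun y hy y' hy' => ?_
    obtain ⟨w, hw, rfl⟩ := Finset.mem_image.1 (Finset.mem_coe.1 hy)
    obtain ⟨w', hw', rfl⟩ := Finset.mem_image.1 (Finset.mem_coe.1 hy')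
    calc edist (r' w) (r' w') = edist (ψ.toFun (r' w)) (ψ.toFun (r' w')) :=
          (ψ.isometry.edist_eq _ _).symm
      _ ≤ edist (ψ.toFun (r' w)) (φ.toFun (r w)) + edist (φ.toFun (r w)) (φ.toFun (r w')) +
          edist (φ.toFun (r w')) (ψ.toFun (r' w')) := edist_triangle4 _ _ _ _
      _ ≤ δ + a 0 + δ := by
          refine add_le_add (add_le_add ?_ ?_) (h w')
          · rw [edist_comm]
            exact h w
          · rw [φ.isometry.edist_eq]
            exact (Metric.edist_le_ediam_of_mem (Finset.mem_coe.2 (Finset.mem_image_of_mem r hw))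
              (Finset.mem_coe.2 (Finset.mem_image_of_mem r hw'))).trans h2
      _ = ((a 0 + 2 * δ : ℝ≥0) : ℝ≥0∞) := by
          push_cast
          ring
  · change _ ≤ ((a 1 + 2 * δ : ℝ≥0) : ℝ≥0∞) / 2
    rw [← coe_div_two_add]
    refine (radius_le_add ?_).trans (add_le_add_left h3 _)
    rintro _ ⟨y, hy, rfl⟩
    obtain ⟨w, hw, rfl⟩ := Finset.mem_image.1 (Finset.mem_coe.1 hy)
    refine ⟨X.proj (r w), ⟨r w, Finset.mem_coe.2 (Finset.mem_image_of_mem r hw), rfl⟩, ?_⟩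
    rw [← φ.comm, ← ψ.comm]
    exact (Z.edist_proj_le _ _).trans (h w)

/-- The retractions `r` and `r'` of `X ⊕ Y` are the identity on one summand and choose a point
closer than `δ` on the other. -/
theorem homotopyInterleaved_ripsBifiltration {X Y Z : BField.{u, v} B} (φ : BFieldEmbedding X Z)
    (ψ : BFieldEmbedding Y Z) {δ : ℝ≥0}
    (h : Metric.hausdorffEDist (Set.range φ.toFun) (Set.range ψ.toFun) < δ) :
    HomotopyInterleaved (2 * δ) (filtrationDiagram (ripsBifiltration X))
      (filtrationDiagram (ripsBifiltration Y)) := by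
  classical
  have hf : ∀ x, ∃ y, edist (φ.toFun x) (ψ.toFun y) < δ := fun x => by
    obtain ⟨_, ⟨y, rfl⟩, hy⟩ := Metric.exists_edist_lt_of_hausdorffEDist_lt (Set.mem_range_self x) h
    exact ⟨y, hy⟩
  have hg : ∀ y, ∃ x, edist (φ.toFun x) (ψ.toFun y) < δ := fun y => by
    rw [Metric.hausdorffEDist_comm] at h
    obtain ⟨_, ⟨x, rfl⟩, hx⟩ := Metric.exists_edist_lt_of_hausdorffEDist_lt (Set.mem_range_self y) h
    exact ⟨x, by rwa [edist_comm]⟩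
  choose f hf using hf
  choose g hg using hg
  let r : X ⊕ Y → X := Sum.elim id g
  let r' : X ⊕ Y → Y := Sum.elim f id
  have hr : ∀ w, edist (φ.toFun (r w)) (ψ.toFun (r' w)) ≤ δ := by
    rintro (x | y)
    · exact (hf x).le
    · exact (hg y).le
  have hr' : ∀ w, edist (ψ.toFun (r' w)) (φ.toFun (r w)) ≤ δ := fun w => by
    rw [edist_comm]
    exact hr w
  exact ⟨_, _, .rel _ _ (hasObjectwiseWeakEquiv_comapFiltration _ Sum.inl r fun _ => rfl),
    .rel _ _ (hasObjectwiseWeakEquiv_comapFiltration _ Sum.inr r' fun _ => rfl),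
    interleaved_of_le _ _ _ (comapFiltration_ripsBifiltration_le φ ψ r r' hr)
      (comapFiltration_ripsBifiltration_le ψ φ r' r hr')⟩

/-! ### Trifiltrations and the Prokhorov distance -/

/-- The vertices of the trifiltration at a given index. -/
def borelFamily (X : MMField.{u, v} B) (a : Index 3) : Set (Set X.field) :=
  {A | MeasurableSet A ∧ Metric.ediam A ≤ (a 0 : ℝ≥0∞) ∧
    radius (X.field.proj '' A) ≤ (a 1 : ℝ≥0∞) / 2 ∧
    1 - (a 2 : ℝ≥0∞) ≤ (X.measure : Measure X.field) A}

lemma borelFamily_mono (X : MMField.{u, v} B) : Monotone (borelFamily X) := fun _ _ hab _ h =>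
  ⟨h.1, h.2.1.trans (ENNReal.coe_le_coe.2 (hab 0)),
    h.2.2.1.trans (ENNReal.div_le_div_right (ENNReal.coe_le_coe.2 (hab 1)) 2),
    (tsub_le_tsub_left (ENNReal.coe_le_coe.2 (hab 2)) 1).trans h.2.2.2⟩

lemma ripsTrifiltration_eq (X : MMField.{u, v} B) : ripsTrifiltration X =
    chainFiltration (fun A C : Set X.field => A ⊆ C) (borelFamily X) (borelFamily_mono X) := rfl

/-- The metric measure field obtained by pushing the measure forward along an embedding. -/
def MMField.pushforward (X : MMField.{u, v} B) {Z : BField.{u, v} B}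
    (φ : BFieldEmbedding X.field Z) : MMField.{u, v} B where
  field := Z
  measure := X.measure.map φ.isometry.continuous.measurable.aemeasurable

theorem hasObjectwiseWeakEquiv_ripsTrifiltration_pushforward (X : MMField.{u, v} B)
    {Z : BField.{u, v} B} (φ : BFieldEmbedding X.field Z) :
    HasObjectwiseWeakEquiv (filtrationDiagram (ripsTrifiltration X))
      (filtrationDiagram (ripsTrifiltration (X.pushforward φ))) := by
  -- Completeness of the domain makes the image closed, so images of Borel sets are Borel.
  have hφ : MeasurableEmbedding φ.toFun := φ.isometry.isClosedEmbedding.measurableEmbedding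
  have hproj : ∀ A : Set X.field, Z.proj '' (φ.toFun '' A) = X.field.proj '' A := fun A => by
    rw [Set.image_image]
    exact Set.image_congr fun x _ => φ.comm x
  -- The image of the preimage of `C` lies inside `C`, a coreflection for inclusion. Reversing
  -- inclusion makes it a reflection and leaves the chains unchanged.
  rw [ripsTrifiltration_eq, ripsTrifiltration_eq,
    ← chainFiltration_flip (fun A C : Set X.field => A ⊆ C),
    ← chainFiltration_flip (fun A C : Set (X.pushforward φ).field => A ⊆ C)]
  refine hasObjectwiseWeakEquiv_chainFiltration (flip fun A C : Set X.field => A ⊆ C)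
    (flip fun A C : Set Z => A ⊆ C) (fun w => Set.Subset.refl w)
    (fun a b c h h' => Set.Subset.trans h' h) _ _ (fun A => φ.toFun '' A)
    (fun C => φ.toFun ⁻¹' C) (fun A => Set.preimage_image_eq A φ.isometry.injective)
    (fun _ _ h => Set.image_mono h) (fun _ _ h => Set.preimage_mono h)
    (fun C => Set.image_preimage_subset φ.toFun C) ?_ ?_
  · rintro a A ⟨h1, h2, h3, h4⟩
    refine ⟨hφ.measurableSet_image.2 h1, ?_, ?_, ?_⟩
    · exact (φ.isometry.ediam_image A).trans_le h2
    · exact (congrArg radius (hproj A)).trans_le h3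
    · change _ ≤ (X.measure : Measure X.field).map φ.toFun (φ.toFun '' A)
      rwa [hφ.map_apply, Set.preimage_image_eq A φ.isometry.injective]
  · rintro a C ⟨h1, h2, h3, h4⟩
    refine ⟨hφ.measurable h1, ?_, ?_, ?_⟩
    · rw [← φ.isometry.ediam_image]
      exact (Metric.ediam_mono (Set.image_preimage_subset _ _)).trans h2
    · rw [← hproj]
      exact (radius_mono (Set.image_mono (Set.image_preimage_subset _ _))).trans h3
    · change _ ≤ (X.measure : Measure X.field).map φ.toFun C at h4
      rwa [hφ.map_apply] at h4

/-- The preorder on two copies of the power set, in which a set in one copy is below a set in the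
other copy if its thickening is contained in it. -/
def thickeningRel {Z : Type u} [PseudoEMetricSpace Z] (δ : ℝ) :
    Set Z ⊕ Set Z → Set Z ⊕ Set Z → Prop
  | .inl A, .inl C => A ⊆ C
  | .inl A, .inr C => Metric.thickening δ A ⊆ C
  | .inr A, .inl C => Metric.thickening δ A ⊆ C
  | .inr A, .inr C => A ⊆ C

section ThickeningRel

variable {Z : Type u} [PseudoEMetricSpace Z] {δ : ℝ}

lemma thickeningRel_refl (w : Set Z ⊕ Set Z) : thickeningRel δ w w := by
  rcases w with A | A <;> exact Set.Subset.refl A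

/-- Changing copies twice thickens twice, which is more than the plain inclusion needed; `0 < δ`
ensures that a set lies in its thickening. -/
lemma thickeningRel_trans (hδ : 0 < δ) (a b c : Set Z ⊕ Set Z) (hab : thickeningRel δ a b)
    (hbc : thickeningRel δ b c) : thickeningRel δ a c := by
  have h := fun A : Set Z => Metric.self_subset_thickening hδ A
  have hm := fun {A C : Set Z} (hAC : A ⊆ C) => Metric.thickening_subset_of_subset δ hAC
  rcases a with a | a <;> rcases b with b | b <;> rcases c with c | c
  · exact Set.Subset.trans hab hbc
  · exact (hm hab).trans hbc
  · exact ((h a).trans hab).trans ((h b).trans hbc)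
  · exact Set.Subset.trans hab hbc
  · exact Set.Subset.trans hab hbc
  · exact ((h a).trans hab).trans ((h b).trans hbc)
  · exact (hm hab).trans hbc
  · exact Set.Subset.trans hab hbc

end ThickeningRel

/-- The family delayed by `δ`. -/
def delayed {V : Type*} {n : ℕ} (δ : ℝ≥0) (S : Index n → Set V) (a : Index n) : Set V :=
  {v | ∃ b, shift n δ b ≤ a ∧ v ∈ S b}

lemma delayed_mono {V : Type*} {n : ℕ} (δ : ℝ≥0) (S : Index n → Set V) : Monotone (delayed δ S) :=
  fun _ _ hab _ ⟨b, hb, hv⟩ => ⟨b, hb.trans hab, hv⟩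

lemma le_shift {n : ℕ} (δ : ℝ≥0) (a : Index n) : a ≤ shift n δ a := fun _ => le_self_add

lemma delayed_subset_shift {V : Type*} {n : ℕ} (δ : ℝ≥0) {S : Index n → Set V} (hS : Monotone S)
    (a : Index n) : delayed δ S a ⊆ S (shift n δ a) := fun _ ⟨b, hb, hv⟩ =>
  hS (((le_shift δ b).trans hb).trans (le_shift δ a)) hv

lemma subset_delayed_shift {V : Type*} {n : ℕ} (δ : ℝ≥0) (S : Index n → Set V)
    (a : Index n) : S a ⊆ delayed δ S (shift n δ a) := fun _ hv => ⟨a, le_rfl, hv⟩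

/-- The family on a sum type given by families on the summands. -/
def sumFamily {V W : Type*} {n : ℕ} (S : Index n → Set V) (T : Index n → Set W) (a : Index n) :
    Set (V ⊕ W) :=
  {w | Sum.elim (· ∈ S a) (· ∈ T a) w}

lemma sumFamily_mono {V W : Type*} {n : ℕ} {S : Index n → Set V} {T : Index n → Set W}
    (hS : Monotone S) (hT : Monotone T) : Monotone (sumFamily S T) := by
  rintro a b hab (v | w) h
  · exact hS hab h
  · exact hT hab h

lemma thickening_mem_borelFamily {Z : BField.{u, v} B} {μ ν : ProbabilityMeasure Z} {δ : ℝ≥0}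
    (h : levyProkhorovEDist (μ : Measure Z) (ν : Measure Z) < δ) {a : Index 3} {A : Set Z}
    (hA : A ∈ delayed (2 * δ) (borelFamily ⟨Z, μ⟩) a) :
    Metric.thickening δ A ∈ borelFamily ⟨Z, ν⟩ a := by
  obtain ⟨b, hb, h1, h2, h3, h4⟩ := hA
  refine borelFamily_mono _ hb ⟨Metric.isOpen_thickening.measurableSet, ?_, ?_, ?_⟩
  · change _ ≤ ((b 0 + 2 * δ : ℝ≥0) : ℝ≥0∞)
    refine (Metric.ediam_thickening_le δ).trans ?_
    push_cast
    exact add_le_add_left h2 _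
  · change _ ≤ ((b 1 + 2 * δ : ℝ≥0) : ℝ≥0∞) / 2
    rw [← coe_div_two_add]
    refine (radius_le_add ?_).trans (add_le_add_left h3 _)
    rintro _ ⟨y, hy, rfl⟩
    obtain ⟨x, hx, hxy⟩ := (Metric.mem_thickening_iff_exists_edist_lt _ _).1 hy
    refine ⟨Z.proj x, ⟨x, hx, rfl⟩, (Z.edist_proj_le x y).trans ?_⟩
    rw [edist_comm]
    simpa using hxy.le
  · change 1 - ((b 2 + 2 * δ : ℝ≥0) : ℝ≥0∞) ≤ (ν : Measure Z) (Metric.thickening δ A)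
    have h5 : (μ : Measure Z) A ≤ (ν : Measure Z) (Metric.thickening δ A) + δ := by
      simpa using left_measure_le_of_levyProkhorovEDist_lt h h1
    -- The measure bound needs only a shift by `δ`; the diagonal shift supplies `2δ`.
    have h6 : (δ : ℝ≥0∞) ≤ ((2 * δ : ℝ≥0) : ℝ≥0∞) := by
      rw [two_mul]
      exact_mod_cast le_self_add
    rw [ENNReal.coe_add, tsub_le_iff_right]
    calc (1 : ℝ≥0∞) ≤ (μ : Measure Z) A + b 2 := tsub_le_iff_right.1 h4
      _ ≤ (ν : Measure Z) (Metric.thickening δ A) + δ + b 2 := add_le_add_left h5 _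
      _ ≤ (ν : Measure Z) (Metric.thickening δ A) + ((b 2 : ℝ≥0∞) + ((2 * δ : ℝ≥0) : ℝ≥0∞)) := by
          rw [add_assoc, add_comm (δ : ℝ≥0∞)]
          gcongr

theorem homotopyInterleaved_ripsTrifiltration_of_measures {Z : BField.{u, v} B}
    {μ ν : ProbabilityMeasure Z} {δ : ℝ≥0}
    (h : levyProkhorovEDist (μ : Measure Z) (ν : Measure Z) < δ) :
    HomotopyInterleaved (2 * δ) (filtrationDiagram (ripsTrifiltration ⟨Z, μ⟩))
      (filtrationDiagram (ripsTrifiltration ⟨Z, ν⟩)) := by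
  have hδ : (0 : ℝ) < δ := by
    have : (0 : ℝ≥0∞) < δ := bot_le.trans_lt h
    exact_mod_cast this
  have h' : levyProkhorovEDist (ν : Measure Z) (μ : Measure Z) < δ := by
    rwa [levyProkhorovEDist_comm]
  have hthick : ∀ A : Set Z, A ⊆ Metric.thickening δ A := Metric.self_subset_thickening hδ
  let S := borelFamily ⟨Z, μ⟩
  let T := borelFamily ⟨Z, ν⟩
  have hS : Monotone S := borelFamily_mono _
  have hT : Monotone T := borelFamily_mono _
  -- Each common filtration keeps one family on time and delays the other, so that thickenings of
  -- delayed sets are already admissible. Passing between the two costs one shift by `2δ`.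
  have hP := sumFamily_mono hS (delayed_mono (2 * δ) T)
  have hQ := sumFamily_mono (delayed_mono (2 * δ) S) hT
  rw [ripsTrifiltration_eq, ripsTrifiltration_eq]
  refine ⟨_, _,
    .rel _ _ (hasObjectwiseWeakEquiv_chainFiltration _ (thickeningRel (δ : ℝ)) thickeningRel_refl
      (thickeningRel_trans hδ) hS hP Sum.inl (Sum.elim id (Metric.thickening δ))
      (fun _ => rfl) (fun _ _ h => h) ?_ ?_ (fun a A hA => hA) ?_),
    .rel _ _ (hasObjectwiseWeakEquiv_chainFiltration _ (thickeningRel (δ : ℝ)) thickeningRel_refl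
      (thickeningRel_trans hδ) hT hQ Sum.inr (Sum.elim (Metric.thickening δ) id)
      (fun _ => rfl) (fun _ _ h => h) ?_ ?_ (fun a A hA => hA) ?_),
    interleaved_of_le _ _ (2 * δ) ?_ ?_⟩
  · rintro (A | A) (C | C) hAC
    · exact hAC
    · exact ((hthick A).trans hAC).trans (hthick C)
    · exact hAC
    · exact Metric.thickening_subset_of_subset _ hAC
  · rintro (A | A)
    · exact Set.Subset.refl A
    · exact Set.Subset.refl _
  · rintro a (A | A) hA
    · exact hA
    · exact thickening_mem_borelFamily h' hA
  · rintro (A | A) (C | C) hAC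
    · exact Metric.thickening_subset_of_subset _ hAC
    · exact hAC
    · exact ((hthick A).trans hAC).trans (hthick C)
    · exact hAC
  · rintro (A | A)
    · exact Set.Subset.refl _
    · exact Set.Subset.refl A
  · rintro a (A | A) hA
    · exact thickening_mem_borelFamily h hA
    · exact hA
  · rintro a σ ⟨h1, h2, h3⟩
    refine ⟨h1, h2, ?_⟩
    rintro (A | A) hA
    · exact subset_delayed_shift (2 * δ) S a (h3 _ hA)
    · exact delayed_subset_shift (2 * δ) hT a (h3 _ hA)
  · rintro a σ ⟨h1, h2, h3⟩
    refine ⟨h1, h2, ?_⟩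
    rintro (A | A) hA
    · exact delayed_subset_shift (2 * δ) hS a (h3 _ hA)
    · exact subset_delayed_shift (2 * δ) T a (h3 _ hA)

lemma HomotopyInterleaved.of_weaklyEquivalent {n : ℕ} {δ : ℝ≥0} {F F' G G' : Index n ⥤ TopCat.{u}}
    (hF : WeaklyEquivalent F F') (hG : WeaklyEquivalent G G') (h : HomotopyInterleaved δ F' G') :
    HomotopyInterleaved δ F G := by
  obtain ⟨F₁, G₁, hF₁, hG₁, hI⟩ := h
  exact ⟨F₁, G₁, hF.trans _ _ _ hF₁, hG.trans _ _ _ hG₁, hI⟩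

theorem homotopyInterleaved_ripsTrifiltration {X Y : MMField.{u, v} B} {Z : BField.{u, v} B}
    (φ : BFieldEmbedding X.field Z) (ψ : BFieldEmbedding Y.field Z) {δ : ℝ≥0}
    (h : levyProkhorovEDist ((X.measure : Measure X.field).map φ.toFun)
      ((Y.measure : Measure Y.field).map ψ.toFun) < δ) :
    HomotopyInterleaved (2 * δ) (filtrationDiagram (ripsTrifiltration X))
      (filtrationDiagram (ripsTrifiltration Y)) :=
  .of_weaklyEquivalent (.rel _ _ (hasObjectwiseWeakEquiv_ripsTrifiltration_pushforward X φ))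
    (.rel _ _ (hasObjectwiseWeakEquiv_ripsTrifiltration_pushforward Y ψ))
    (homotopyInterleaved_ripsTrifiltration_of_measures h)

/-- An interleaving is available only for `δ` strictly above `c`, whence the limit `ε → 0`. With the
factor `2` moved to the left, the infimum over embeddings can be taken on the right directly. -/
lemma homotopyInterleavingDist_le_two_mul {n : ℕ} {F G : Index n ⥤ TopCat.{u}} {c : ℝ≥0∞}
    (h : ∀ δ : ℝ≥0, c < δ → HomotopyInterleaved (2 * δ) F G) :
    homotopyInterleavingDist F G / 2 ≤ c := by
  refine ENNReal.le_of_forall_pos_le_add fun ε hε hc => ?_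
  lift c to ℝ≥0 using hc.ne
  have h1 := h (c + ε) (by exact_mod_cast lt_add_of_pos_right c hε)
  rw [← ENNReal.coe_add]
  refine ENNReal.div_le_of_le_mul ?_
  rw [mul_comm]
  exact_mod_cast iInf₂_le (2 * (c + ε)) h1

end Comparison

end FieldVR

end

open FieldVR in
theorem theorem6p4 {B : Type v} [MetricSpace B] [CompleteSpace B]
    [TopologicalSpace.SeparableSpace B] (X Y : MMField.{u, v} B) :
    homotopyInterleavingDist (filtrationDiagram (ripsBifiltration X.field))
        (filtrationDiagram (ripsBifiltration Y.field)) ≤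
      2 * gromovHausdorffDist X.field Y.field ∧
    homotopyInterleavingDist (filtrationDiagram (ripsTrifiltration X))
        (filtrationDiagram (ripsTrifiltration Y)) ≤
      2 * gromovProkhorovDist X Y := by
  constructor
  · refine (ENNReal.div_le_iff' two_ne_zero ENNReal.ofNat_ne_top).1 ?_
    exact le_iInf fun Z => le_iInf fun φ => le_iInf fun ψ =>
      homotopyInterleavingDist_le_two_mul fun δ h => homotopyInterleaved_ripsBifiltration φ ψ h
  · refine (ENNReal.div_le_iff' two_ne_zero ENNReal.ofNat_ne_top).1 ?_
    exact le_iInf fun Z => le_iInf fun φ => le_iInf fun ψ =>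
      homotopyInterleavingDist_le_two_mul fun δ h => homotopyInterleaved_ripsTrifiltration φ ψ h
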